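/- Let $b_{ij},\tilde b_{ij}$ ($i,j\in\mathbb{N}=\{1,2,\dots\}$) be jointly independent standard real Brownian motions on a probability space, and set $B_{ij}(t)=\tfrac{1}{\sqrt2}b_{ij}(t)+\tfrac{\mathrm i}{\sqrt2}\tilde b_{ij}(t)$. For $N\in\mathbb{N}$, $\alpha\in\mathbb{N}_0$ and $t\ge 0$ let $A^N(\alpha,t)=(B_{ij}(t))_{1\le i\le N+\alpha,\,1\le j\le N}$, and let $\vec X^N(\alpha,t)=(X^N_1(\alpha,t)\le\dots\le X^N_N(\alpha,t))\in\mathbb{R}^N$ be the vector of ordered eigenvalues (with multiplicity) of $A^N(\alpha,t)^*A^N(\alpha,t)$. Call a finite sequence $(\alpha^{(k)},t^{(k)})_{k=1}^m$ in $\mathbb{N}_0\times[0,\infty)$ time-like if for all $1\le k<m$ one has $\alpha^{(k)}\le\alpha^{(k+1)}$, $t^{(k)}\le t^{(k+1)}$ and $(\alpha^{(k)},t^{(k)})\ne(\alpha^{(k+1)},t^{(k+1)})$, and space-like if for all $1\le k<m$ one has $\alpha^{(k)}\ge\alpha^{(k+1)}$, $t^{(k)}\le t^{(k+1)}$ and $(\alpha^{(k)},t^{(k)})\ne(\alpha^{(k+1)},t^{(k+1)})$.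 Fix $N$ and $m$ in $\mathbb{N}$, let $(\alpha^{(k)},t^{(k)})_{k=1}^m$ be a time-like or a space-like path, and put $\vec X^{(k)}=\vec X^N(\alpha^{(k)},t^{(k)})$. Then $(\vec X^{(k)})_{k=1}^m$ is a (in general time-inhomogeneous) Markov chain: each $\vec X^{(k)}$ is a random vector, and for every $1\le k<m$ and every Borel set $S\subset\mathbb{R}^N$, almost surely $$\mathbb{P}\big(\vec X^{(k+1)}\in S\,\big|\,\vec X^{(1)},\dots,\vec X^{(k)}\big)=\mathbb{P}\big(\vec X^{(k+1)}\in S\,\big|\,\vec X^{(k)}\big).$$ -/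

import Mathlib

open MeasureTheory ProbabilityTheory
open scoped NNReal ProbabilityTheory

namespace LaguerreField

/-- `(α, t) ≺ₜ (β, s)`: `α ≤ β`, `t ≤ s` and `(α, t) ≠ (β, s)`. -/
def TimePrec (p q : ℕ × ℝ≥0) : Prop :=
  p.1 ≤ q.1 ∧ p.2 ≤ q.2 ∧ p ≠ q

/-- `(α, t) ≺ₛ (β, s)`: `α ≥ β`, `t ≤ s` and `(α, t) ≠ (β, s)`. -/
def SpacePrec (p q : ℕ × ℝ≥0) : Prop :=
  q.1 ≤ p.1 ∧ p.2 ≤ q.2 ∧ p ≠ q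

/-- A path is time-like if consecutive points are related by `≺ₜ`. -/
def IsTimeLike {m : ℕ} (p : Fin m → ℕ × ℝ≥0) : Prop :=
  ∀ (k : ℕ) (hk : k + 1 < m), TimePrec (p ⟨k, k.lt_succ_self.trans hk⟩) (p ⟨k + 1, hk⟩)

/-- A path is space-like if consecutive points are related by `≺ₛ`. -/
def IsSpaceLike {m : ℕ} (p : Fin m → ℕ × ℝ≥0) : Prop :=
  ∀ (k : ℕ) (hk : k + 1 < m), SpacePrec (p ⟨k, k.lt_succ_self.trans hk⟩) (p ⟨k + 1, hk⟩)

/-- `b i j` and `c i j` (`i, j ∈ ℕ`) are jointly independent standard real Brownian motions. -/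
structure IsBrownianFamily {Ω : Type*} [MeasurableSpace Ω] (b c : ℕ → ℕ → ℝ≥0 → Ω → ℝ)
    (P : Measure Ω) : Prop where
  measurable_left : ∀ i j t, Measurable (b i j t)
  measurable_right : ∀ i j t, Measurable (c i j t)
  brownian_left : ∀ i j, IsBrownianReal (b i j) P
  brownian_right : ∀ i j, IsBrownianReal (c i j) P
  indep : iIndepFun (fun (q : (ℕ × ℕ) ⊕ (ℕ × ℕ)) (ω : Ω) (t : ℝ≥0) =>
    Sum.elim (fun ij => b ij.1 ij.2 t ω) (fun ij => c ij.1 ij.2 t ω) q) P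

variable {Ω : Type*}

/-- The complex Brownian motion `B i j = b i j / √2 + 𝐢 c i j / √2`. -/
noncomputable def complexBM (b c : ℕ → ℕ → ℝ≥0 → Ω → ℝ) (i j : ℕ) (t : ℝ≥0) (ω : Ω) : ℂ :=
  ((b i j t ω / √2 : ℝ) : ℂ) + Complex.I * ((c i j t ω / √2 : ℝ) : ℂ)

/-- The `(N + α) × N` random matrix with entries `B i j (t)` (indices start at `0`). -/
noncomputable def randMatrix (b c : ℕ → ℕ → ℝ≥0 → Ω → ℝ) (N α : ℕ) (t : ℝ≥0) (ω : Ω) :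
    Matrix (Fin (N + α)) (Fin N) ℂ :=
  Matrix.of fun i j => complexBM b c i j t ω

/-- The eigenvalues, with multiplicity, of a Hermitian `N × N` matrix in nondecreasing order.
(Mathlib's `eigenvalues₀` lists them in nonincreasing order.) -/
noncomputable def orderedEigenvalues {N : ℕ} {M : Matrix (Fin N) (Fin N) ℂ}
    (hM : M.IsHermitian) (j : Fin N) : ℝ :=
  hM.eigenvalues₀ (Fin.cast (Fintype.card_fin N).symm j.rev)

/-- The vector of ordered eigenvalues of `A* A`, where `A` is the `(N + α) × N` matrix above. -/
noncomputable def eigenvalueVector (b c : ℕ → ℕ → ℝ≥0 → Ω → ℝ) (N α : ℕ) (t : ℝ≥0)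
    (ω : Ω) : Fin N → ℝ :=
  orderedEigenvalues (Matrix.isHermitian_conjTranspose_mul_self (randMatrix b c N α t ω))

/-- A finite sequence of random variables is a (possibly time-inhomogeneous) Markov chain: the
conditional law of the next value given the whole past is its conditional law given the present. -/
structure IsMarkovChain {Ω E : Type*} [MeasurableSpace Ω] [mE : MeasurableSpace E] {m : ℕ}
    (X : Fin m → Ω → E) (P : Measure Ω) : Prop where
  measurable : ∀ k, Measurable (X k)
  markov : ∀ (k : ℕ) (hk : k + 1 < m) (S : Set E), MeasurableSet S →
    P⟦X ⟨k + 1, hk⟩ ⁻¹' S |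
        ⨆ j : {j : Fin m // (j : ℕ) ≤ k}, MeasurableSpace.comap (X j) mE⟧
      =ᵐ[P]
    P⟦X ⟨k + 1, hk⟩ ⁻¹' S | MeasurableSpace.comap (X ⟨k, k.lt_succ_self.trans hk⟩) mE⟧

end LaguerreField

/-! Fix a present point `(α, s)` and put `n = N + α`. A Brownian motion splits as `B t = r * B s +
residual` with `r = min t s / s` (`r = 0` if `s = 0`), and the residual is independent of the path
on the side of `s` opposite to `t`, in either direction of time. Hence the matrices at points with
at least `n` rows on one side of `s` are functions of the `n × N` matrix `a` at time `s` and of a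
Gaussian array `W` independent of the first `n` rows on the other side
(`indepFun_observed_residual`). The law of `W` is invariant under unitaries acting on the top `n`
rows from the left and on the columns from the right (`map_residual_rotate`), and the eigenvalues do
not see such unitaries. Writing `a = U * D * V` by singular values, the conditional law of the
eigenvalues given `a` depends on `D` alone, that is, on the present eigenvalues
(`measure_updatedEigenvalues_eq`, `condExp_eigenvalueVector`). On a time-like path the past is a
function of the first `n` rows up to time `s`, and the result applies directly. On a space-like path
it applies backwards in time: the past points have more rows, and the next point is a function of
the first `n` rows from time `s` on. Symmetry of conditional independence
(`condExp_eq_of_condExp_swap`) then gives the Markov property. -/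

namespace LaguerreField
open Matrix

/-! ### Ordered eigenvalues and the singular value decomposition. -/

/-- The ordered eigenvalues of `Aᴴ * A`. -/
noncomputable def gramEigenvalues {R : Type*} [Fintype R] {N : ℕ} (A : Matrix R (Fin N) ℂ) :
    Fin N → ℝ :=
  orderedEigenvalues (Matrix.isHermitian_conjTranspose_mul_self A)

lemma orderedEigenvalues_monotone {N : ℕ} {M : Matrix (Fin N) (Fin N) ℂ} (hM : M.IsHermitian) :
    Monotone (orderedEigenvalues hM) := by
  intro i j hij
  apply hM.eigenvalues₀_antitone
  simpa [Fin.le_def] using Fin.rev_le_rev.2 hij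

lemma orderedEigenvalues_congr {N : ℕ} {A B : Matrix (Fin N) (Fin N) ℂ} (hA : A.IsHermitian)
    (hB : B.IsHermitian) (h : A.charpoly = B.charpoly) :
    orderedEigenvalues hA = orderedEigenvalues hB := by
  have : hA.eigenvalues₀ = hB.eigenvalues₀ := by
    simp_rw [← List.ofFn_inj, ← IsHermitian.sort_roots_charpoly_eq_eigenvalues₀, h]
  funext j
  simp [orderedEigenvalues, this]

lemma exists_perm_orderedEigenvalues {N : ℕ} {A : Matrix (Fin N) (Fin N) ℂ}
    (hA : A.IsHermitian) :
    ∃ σ : Equiv.Perm (Fin N), ∀ j, hA.eigenvalues (σ j) = orderedEigenvalues hA j := by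
  refine ⟨(Fin.revPerm.trans (finCongr (Fintype.card_fin N).symm)).trans
    (Fintype.equivOfCardEq (Fintype.card_fin _)), fun j => ?_⟩
  simp [IsHermitian.eigenvalues, orderedEigenvalues]

lemma charpoly_eq_prod_orderedEigenvalues {N : ℕ} {A : Matrix (Fin N) (Fin N) ℂ}
    (hA : A.IsHermitian) :
    A.charpoly = ∏ j, (Polynomial.X - Polynomial.C ((orderedEigenvalues hA j : ℝ) : ℂ)) := by
  obtain ⟨σ, hσ⟩ := exists_perm_orderedEigenvalues hA
  rw [hA.charpoly_eq, ← Equiv.prod_comp σ]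
  simp [hσ]

lemma exists_unitary_diagonal_orderedEigenvalues {N : ℕ} {A : Matrix (Fin N) (Fin N) ℂ}
    (hA : A.IsHermitian) :
    ∃ V ∈ unitaryGroup (Fin N) ℂ,
      Vᴴ * A * V = diagonal (fun j => ((orderedEigenvalues hA j : ℝ) : ℂ)) := by
  obtain ⟨σ, hσ⟩ := exists_perm_orderedEigenvalues hA
  set W : Matrix (Fin N) (Fin N) ℂ := hA.eigenvectorUnitary.1
  have hW : Wᴴ * W = 1 := mem_unitaryGroup_iff'.1 hA.eigenvectorUnitary.2
  have hdiag : Wᴴ * A * W = diagonal (fun j => ((hA.eigenvalues j : ℝ) : ℂ)) := by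
    have h := hA.spectral_theorem
    rw [Unitary.conjStarAlgAut_apply] at h
    conv_lhs => rw [h]
    change Wᴴ * (W * _ * Wᴴ) * W = _
    rw [show ∀ D : Matrix (Fin N) (Fin N) ℂ, Wᴴ * (W * D * Wᴴ) * W = (Wᴴ * W) * D * (Wᴴ * W) by
      intro D; simp only [Matrix.mul_assoc], hW, Matrix.one_mul, Matrix.mul_one]
    rfl
  have hsub : ∀ M : Matrix (Fin N) (Fin N) ℂ,
      (W.submatrix id σ)ᴴ * M * W.submatrix id σ = (Wᴴ * M * W).submatrix σ σ := fun _ => rfl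
  refine ⟨W.submatrix id σ, ?_, ?_⟩
  · have h := hsub 1
    rw [Matrix.mul_one, Matrix.mul_one, hW, submatrix_one_equiv] at h
    exact mem_unitaryGroup_iff'.2 h
  · rw [hsub, hdiag, submatrix_diagonal_equiv]
    simp [Function.comp_def, hσ]

open scoped ComplexOrder in
lemma gramEigenvalues_nonneg {R : Type*} [Fintype R] {N : ℕ}
    (A : Matrix R (Fin N) ℂ) (j : Fin N) : 0 ≤ gramEigenvalues A j := by
  obtain ⟨σ, hσ⟩ := exists_perm_orderedEigenvalues (isHermitian_conjTranspose_mul_self A)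
  rw [gramEigenvalues, ← hσ]
  exact (posSemidef_conjTranspose_mul_self A).eigenvalues_nonneg _

lemma inner_toEuclideanLin_self {R : Type*} [Fintype R] {n : Type*} [Fintype n] [DecidableEq n]
    (A : Matrix R n ℂ) (x y : EuclideanSpace ℂ n) :
    inner ℂ (toEuclideanLin A x) (toEuclideanLin A y) =
      star x.ofLp ⬝ᵥ ((Aᴴ * A) *ᵥ y.ofLp) := by
  rw [EuclideanSpace.inner_eq_star_dotProduct, ← mulVec_mulVec, dotProduct_mulVec,
    ← star_mulVec, dotProduct_comm]
  rfl

/-- Two matrices with the same Gram matrix differ by a unitary factor. -/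
lemma exists_unitary_mul_of_gram_eq {R : Type*} [Fintype R] [DecidableEq R] {N : ℕ}
    {A B : Matrix R (Fin N) ℂ} (h : Aᴴ * A = Bᴴ * B) :
    ∃ U ∈ unitaryGroup R ℂ, A = U * B := by
  classical
  let a := toEuclideanLin A
  let b := toEuclideanLin B
  have hn : ∀ x, ‖a x‖ = ‖b x‖ := fun x => by
    rw [@norm_eq_sqrt_re_inner ℂ, @norm_eq_sqrt_re_inner ℂ, inner_toEuclideanLin_self, h,
      ← inner_toEuclideanLin_self]
  have hk : LinearMap.ker b.rangeRestrict ≤ LinearMap.ker a := by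
    intro x hx
    rw [LinearMap.ker_rangeRestrict, LinearMap.mem_ker] at hx
    rw [LinearMap.mem_ker, ← norm_eq_zero, hn, hx, norm_zero]
  -- A linear section `g` of `b` turns `b x ↦ a x` into a map on the range of `b`. It is isometric
  -- because `‖a x‖ = ‖b x‖`, so it extends to a unitary of the whole space.
  obtain ⟨g, hg⟩ := b.rangeRestrict.exists_rightInverse_of_surjective b.range_rangeRestrict
  let L : LinearMap.range b →ₗ[ℂ] EuclideanSpace ℂ R := a ∘ₗ g
  have hbg : ∀ y, b (g y) = y := fun y => congrArg Subtype.val (LinearMap.congr_fun hg y)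
  let Li : LinearMap.range b →ₗᵢ[ℂ] EuclideanSpace ℂ R :=
    ⟨L, fun y => by simp only [L, LinearMap.comp_apply, hn, hbg]; rfl⟩
  have hLi : ∀ x, Li (b.rangeRestrict x) = a x := by
    intro x
    change a (g (b.rangeRestrict x)) = a x
    rw [← sub_eq_zero, ← map_sub, ← norm_eq_zero, hn, map_sub, hbg]
    simp
  let U : Matrix R R ℂ := toEuclideanLin.symm Li.extend.toLinearMap
  have hU : ∀ x, toEuclideanLin U x = Li.extend x := fun x => by simp [U]
  refine ⟨U, mem_unitaryGroup_iff'.2 ?_, ?_⟩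
  · ext i j
    have h1 := inner_toEuclideanLin_self U (EuclideanSpace.single i 1) (EuclideanSpace.single j 1)
    rw [hU, hU, LinearIsometry.inner_map_map] at h1
    rw [EuclideanSpace.inner_single_left] at h1
    simpa [one_apply, star_eq_conjTranspose, eq_comm] using h1.symm
  · apply toEuclideanLin.injective
    ext1 x
    have h2 : toEuclideanLin (U * B) x = toEuclideanLin U (b x) := by
      simp [b, toLpLin_apply, mulVec_mulVec]
    rw [h2, hU]
    exact ((hLi x).symm.trans (Li.extend_apply _).symm)

/-- The rectangular matrix with the square roots of `x` on its diagonal. -/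
noncomputable def rectDiagonal {N : ℕ} (n : ℕ) (x : Fin N → ℝ) : Matrix (Fin n) (Fin N) ℂ :=
  Matrix.of fun i j => if (i : ℕ) = j then ((√(x j) : ℝ) : ℂ) else 0

lemma gram_rectDiagonal {N : ℕ} (α : ℕ) {x : Fin N → ℝ} (hx : ∀ j, 0 ≤ x j) :
    (rectDiagonal (N + α) x)ᴴ * rectDiagonal (N + α) x = diagonal (fun j => ((x j : ℝ) : ℂ)) := by
  ext j k
  rw [mul_apply, Finset.sum_eq_single (Fin.castAdd α j)]
  · by_cases hjk : j = k
    · subst hjk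
      simp [rectDiagonal, ← Complex.ofReal_mul, Real.mul_self_sqrt (hx j)]
    · simp [rectDiagonal, hjk, Fin.val_inj]
  · intro i _ hi
    have : (i : ℕ) ≠ j := fun h => hi (Fin.ext (by simpa using h))
    simp [rectDiagonal, this]
  · simp

/-- If `V` diagonalises `Aᴴ * A`, then `A * V` has the same Gram matrix as the rectangular diagonal
matrix, so the two differ by a unitary on the left. -/
lemma exists_singular_value_decomposition {N α : ℕ} (A : Matrix (Fin (N + α)) (Fin N) ℂ) :
    ∃ U ∈ unitaryGroup (Fin (N + α)) ℂ, ∃ V ∈ unitaryGroup (Fin N) ℂ,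
      A = U * rectDiagonal (N + α) (gramEigenvalues A) * V := by
  obtain ⟨V, hV, hd⟩ := exists_unitary_diagonal_orderedEigenvalues
    (isHermitian_conjTranspose_mul_self A)
  obtain ⟨U, hU, h⟩ := exists_unitary_mul_of_gram_eq (A := A * V)
    (B := rectDiagonal (N + α) (gramEigenvalues A)) (by
      rw [gram_rectDiagonal α (gramEigenvalues_nonneg A), conjTranspose_mul,
        ← Matrix.mul_assoc, Matrix.mul_assoc Vᴴ, hd]
      rfl)
  refine ⟨U, hU, star V, Unitary.star_mem hV, ?_⟩
  rw [← h, Matrix.mul_assoc, mem_unitaryGroup_iff.1 hV, Matrix.mul_one]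

lemma gramEigenvalues_eq_of_gram_eq {R R' : Type*} [Fintype R] [Fintype R'] {N : ℕ}
    {A : Matrix R (Fin N) ℂ} {B : Matrix R' (Fin N) ℂ} (h : Aᴴ * A = Bᴴ * B) :
    gramEigenvalues A = gramEigenvalues B :=
  orderedEigenvalues_congr _ _ (by rw [h])

lemma gramEigenvalues_mul_unitary {R : Type*} [Fintype R] {N : ℕ}
    (A : Matrix R (Fin N) ℂ) {V : Matrix (Fin N) (Fin N) ℂ} (hV : V ∈ unitaryGroup (Fin N) ℂ) :
    gramEigenvalues (A * V) = gramEigenvalues A :=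
  orderedEigenvalues_congr _ _ (by
    rw [conjTranspose_mul, Matrix.mul_assoc, charpoly_mul_comm, ← Matrix.mul_assoc,
      Matrix.mul_assoc, Matrix.mul_assoc, ← star_eq_conjTranspose V, mem_unitaryGroup_iff.1 hV,
      Matrix.mul_one])

lemma gramEigenvalues_unitary_mul {R : Type*} [Fintype R] [DecidableEq R] {N : ℕ}
    (A : Matrix R (Fin N) ℂ) {U : Matrix R R ℂ} (hU : U ∈ unitaryGroup R ℂ) :
    gramEigenvalues (U * A) = gramEigenvalues A :=
  gramEigenvalues_eq_of_gram_eq (by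
    rw [conjTranspose_mul, Matrix.mul_assoc, ← Matrix.mul_assoc Uᴴ, ← star_eq_conjTranspose U,
      mem_unitaryGroup_iff'.1 hU, Matrix.one_mul])

/-! ### Measurability of the ordered eigenvalues. -/

lemma injective_eval_prod_sub {N : ℕ} :
    Function.Injective (fun (x : {x : Fin N → ℝ // Monotone x}) (z : ℕ) =>
      ∏ j, ((z : ℂ) - ((x.1 j : ℝ) : ℂ))) := by
  intro x y h
  have hp : ∏ j, (Polynomial.X - Polynomial.C ((x.1 j : ℝ) : ℂ)) =
      ∏ j, (Polynomial.X - Polynomial.C ((y.1 j : ℝ) : ℂ)) := by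
    refine Polynomial.eq_of_infinite_eval_eq _ _
      ((Set.infinite_range_of_injective (Nat.cast_injective (R := ℂ))).mono ?_)
    rintro _ ⟨z, rfl⟩
    simpa [Polynomial.eval_prod] using congrFun h z
  have hr := congrArg Polynomial.roots hp
  simp only [Polynomial.roots_prod _ _
    (Finset.prod_ne_zero_iff.2 fun j _ => Polynomial.X_sub_C_ne_zero _),
    Polynomial.roots_X_sub_C, Multiset.bind_singleton] at hr
  have hr' : Multiset.map x.1 Finset.univ.val = Multiset.map y.1 Finset.univ.val := by
    have := congrArg (Multiset.map Complex.re) hr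
    simpa [Multiset.map_map, Function.comp_def] using this
  have hl : List.ofFn x.1 = List.ofFn y.1 := by
    rw [Fin.univ_val_map, Fin.univ_val_map, Multiset.coe_eq_coe] at hr'
    exact hr'.eq_of_pairwise' (List.sortedLE_iff_pairwise.1 x.2.sortedLE_ofFn)
      (List.sortedLE_iff_pairwise.1 y.2.sortedLE_ofFn)
  exact Subtype.ext (List.ofFn_injective hl)

/-- A monotone vector is determined by the values at the naturals of the monic polynomial with these
roots. By Lusin–Souslin this injection is a measurable embedding, so it suffices that the values of
the characteristic polynomial are measurable; they are determinants in the entries. -/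
lemma measurable_gramEigenvalues {Ω R : Type*} [MeasurableSpace Ω] [Fintype R] {N : ℕ}
    {A : Ω → Matrix R (Fin N) ℂ} (hA : ∀ i j, Measurable fun ω => A ω i j) :
    Measurable fun ω => gramEigenvalues (A ω) := by
  have hs : MeasurableSet {x : Fin N → ℝ | Monotone x} := by
    have : {x : Fin N → ℝ | Monotone x} =
        ⋂ (i : Fin N) (j : Fin N) (_ : i ≤ j), {x | x i ≤ x j} := by
      ext x; simp [Monotone]
    rw [this]
    refine MeasurableSet.iInter fun i => .iInter fun j => .iInter fun _ =>
      measurableSet_le (measurable_pi_apply i) (measurable_pi_apply j)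
  have : StandardBorelSpace {x : Fin N → ℝ // Monotone x} := hs.standardBorel
  have hmeas : Measurable (fun (x : {x : Fin N → ℝ // Monotone x}) (z : ℕ) =>
      ∏ j, ((z : ℂ) - ((x.1 j : ℝ) : ℂ))) := by
    refine measurable_pi_lambda _ fun z => Finset.measurable_fun_prod _ fun j _ =>
      measurable_const.sub (Complex.measurable_ofReal.comp ?_)
    exact (measurable_pi_apply j).comp measurable_subtype_coe
  have hemb : MeasurableEmbedding (fun (x : {x : Fin N → ℝ // Monotone x}) (z : ℕ) =>
      ∏ j, ((z : ℂ) - ((x.1 j : ℝ) : ℂ))) :=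
    Measurable.measurableEmbedding hmeas injective_eval_prod_sub
  have hm : Measurable fun ω => (⟨gramEigenvalues (A ω), orderedEigenvalues_monotone _⟩ :
      {x : Fin N → ℝ // Monotone x}) := by
    rw [← hemb.measurable_comp_iff]
    refine measurable_pi_lambda _ fun z => ?_
    have he : ∀ ω, ∏ j, ((z : ℂ) - ((gramEigenvalues (A ω) j : ℝ) : ℂ)) =
        det (scalar (Fin N) (z : ℂ) - (A ω)ᴴ * A ω) := by
      intro ω
      rw [← eval_charpoly, charpoly_eq_prod_orderedEigenvalues
        (isHermitian_conjTranspose_mul_self (A ω)), Polynomial.eval_prod]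
      simp [gramEigenvalues]
    simp only [Function.comp_def, he, det_apply]
    refine Finset.measurable_fun_sum _ fun σ _ => Measurable.const_smul
      (Finset.measurable_fun_prod _ fun j _ => ?_) _
    simp only [Matrix.sub_apply, Matrix.mul_apply, Matrix.conjTranspose_apply]
    refine measurable_const.sub (Finset.measurable_fun_sum _ fun i _ => ?_)
    exact (Complex.continuous_conj.measurable.comp (hA _ _)).mul (hA _ _)
  exact measurable_subtype_coe.comp hm

/-! ### Gaussian vectors and their orthogonal invariance. -/

section Gaussian

variable {Ω : Type*} [MeasurableSpace Ω] {P : Measure Ω}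

/-- Independent Gaussian processes are jointly Gaussian. -/
lemma isGaussianProcess_of_iIndepFun {ι T : Type*} {X : ι → T → Ω → ℝ}
    (hX : ∀ i, IsGaussianProcess (X i) P) (h : iIndepFun (fun i ω t => X i t ω) P) :
    IsGaussianProcess (fun q : ι × T => X q.1 q.2) P where
  hasGaussianLaw I := by
    classical
    -- The finite set `I` lies in the rectangle `J × K`, where independence of whole rows applies;
    -- `L` restricts back to `I`.
    let J := I.image Prod.fst
    let K := I.image Prod.snd
    have h1 : HasGaussianLaw (fun ω (i : J) => K.restrict (X i · ω)) P :=
      iIndepFun.hasGaussianLaw (fun i => (hX i).hasGaussianLaw K)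
        ((h.precomp Subtype.val_injective).comp (fun _ x => K.restrict x)
          fun _ => Finset.measurable_restrict K)
    let L : (J → K → ℝ) →L[ℝ] (I → ℝ) :=
      { toFun x q := x ⟨q.1.1, Finset.mem_image_of_mem _ q.2⟩ ⟨q.1.2, Finset.mem_image_of_mem _ q.2⟩
        map_add' x y := by ext; simp
        map_smul' c x := by ext; simp }
    exact h1.map_fun L

lemma hasGaussianLaw_of_isGaussianProcess {T : Type*} [Fintype T] {X : T → Ω → ℝ}
    (h : IsGaussianProcess X P) : HasGaussianLaw (fun ω t => X t ω) P := by
  let L : (↥(Finset.univ : Finset T) → ℝ) →L[ℝ] (T → ℝ) :=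
    ContinuousLinearMap.pi fun t => ContinuousLinearMap.proj ⟨t, Finset.mem_univ t⟩
  exact (h.hasGaussianLaw Finset.univ).map_fun L

/-- Gaussian vectors with the same means and covariances have the same law. -/
lemma map_eq_of_covariance_eq {Ω' κ : Type*} [MeasurableSpace Ω'] {P' : Measure Ω'} [Fintype κ]
    [DecidableEq κ] {X : κ → Ω → ℝ} {Y : κ → Ω' → ℝ}
    (hX : HasGaussianLaw (fun ω k => X k ω) P)
    (hY : HasGaussianLaw (fun ω k => Y k ω) P') (hm : ∀ k, P[X k] = P'[Y k])
    (hc : ∀ k l, cov[X k, X l; P] = cov[Y k, Y l; P']) :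
    P.map (fun ω k => X k ω) = P'.map (fun ω k => Y k ω) := by
  have := hX.isProbabilityMeasure
  have := hY.isProbabilityMeasure
  have := hX.isGaussian_map
  have := hY.isGaussian_map
  refine Measure.ext_of_charFunDual (funext fun L => ?_)
  obtain ⟨v, hL⟩ : ∃ v : κ → ℝ, ∀ x : κ → ℝ, L x = ∑ k, v k * x k := by
    refine ⟨fun k => L (Pi.single k 1), fun x => ?_⟩
    conv_lhs => rw [← Finset.univ_sum_single x, map_sum]
    refine Finset.sum_congr rfl fun k _ => ?_
    rw [show Pi.single k (x k) = x k • (Pi.single k 1 : κ → ℝ) by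
      rw [← Pi.single_smul, smul_eq_mul, mul_one], map_smul, smul_eq_mul, mul_comm]
  rw [hX.charFunDual_map_eq_fun, hY.charFunDual_map_eq_fun]
  simp only [hL]
  rw [integral_finsetSum _ fun k _ => (hX.eval k).integrable.const_mul _,
    integral_finsetSum _ fun k _ => (hY.eval k).integrable.const_mul _,
    variance_fun_sum fun k => (hX.eval k).memLp_two.const_mul _,
    variance_fun_sum fun k => (hY.eval k).memLp_two.const_mul _]
  simp only [integral_const_mul, hm, covariance_const_mul_left, covariance_const_mul_right, hc]

/-- Apply the matrix `O` to every time slice. -/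
def rotate {Q ι : Type*} [Fintype Q] (O : Matrix Q Q ℝ) (w : Q × ι → ℝ) : Q × ι → ℝ :=
  fun q => (O *ᵥ fun q' => w (q', q.2)) q.1

lemma measurable_rotate {Q ι : Type*} [Fintype Q] (O : Matrix Q Q ℝ) :
    Measurable (rotate (ι := ι) O) := by
  refine measurable_pi_lambda _ fun q => ?_
  simp only [rotate, mulVec, dotProduct]
  fun_prop

/-- A centered Gaussian family whose rows are independent is invariant in law under orthogonal
matrices that only mix identically distributed rows. -/
lemma map_rotate_eq {Q ι : Type*} [Fintype Q] [DecidableEq Q] [Fintype ι] [DecidableEq ι]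
    {W : Q × ι → Ω → ℝ}
    (hW : HasGaussianLaw (fun ω q => W q ω) P) (hm : ∀ q, P[W q] = 0) (K : Q → ι → ι → ℝ)
    (hc : ∀ q q', cov[W q, W q'; P] = if q.1 = q'.1 then K q.1 q.2 q'.2 else 0)
    {O : Matrix Q Q ℝ} (hO : O * Oᵀ = 1) (hOK : ∀ q q', O q q' ≠ 0 → K q = K q') :
    (P.map fun ω q => W q ω).map (rotate O) = P.map fun ω q => W q ω := by
  rw [AEMeasurable.map_map_of_aemeasurable (measurable_rotate O).aemeasurable hW.aemeasurable]
  have := hW.isProbabilityMeasure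
  have hlp : ∀ q, MemLp (W q) 2 P := fun q => (hW.eval q).memLp_two
  have hG : HasGaussianLaw (fun ω q => (rotate O fun q => W q ω) q) P := by
    let L : (Q × ι → ℝ) →L[ℝ] (Q × ι → ℝ) := LinearMap.toContinuousLinearMap
      { toFun := rotate O
        map_add' x y := by
          ext q; simp [rotate, mulVec, dotProduct, mul_add, Finset.sum_add_distrib]
        map_smul' c x := by
          ext q; simp [rotate, mulVec, dotProduct, Finset.mul_sum, mul_left_comm] }
    exact hW.map_fun L
  refine map_eq_of_covariance_eq (X := fun q ω => rotate O (fun q => W q ω) q) (Y := W) hG hW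
    (fun q => ?_) fun q p => ?_
  · simp only [rotate, mulVec, dotProduct, hm]
    rw [integral_finsetSum _ fun k _ => (hW.eval _).integrable.const_mul _]
    simp [integral_const_mul, hm]
  · simp only [rotate, mulVec, dotProduct]
    rw [covariance_fun_sum_fun_sum (fun k => (hlp _).const_mul _) (fun k => (hlp _).const_mul _)]
    simp only [covariance_const_mul_left, covariance_const_mul_right]
    -- Distinct rows are uncorrelated, so only `j = i` survives. Where `O q.1 i ≠ 0` the kernel `K
    -- i` equals `K q.1` and factors out, leaving an entry of `O * Oᵀ`.
    have hrow : ∀ i, ∑ j, O p.1 j * (O q.1 i * cov[W (i, q.2), W (j, p.2); P]) =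
        O q.1 i * Oᵀ i p.1 * K q.1 q.2 p.2 := by
      intro i
      simp only [hc]
      rw [Finset.sum_eq_single i (fun j _ hj => by simp [hj.symm]) (by simp)]
      by_cases h0 : O q.1 i = 0
      · simp [h0]
      · rw [hOK _ _ h0]; simp; ring
    simp only [hrow]
    rw [← Finset.sum_mul, ← mul_apply, hO, hc, one_apply]
    split_ifs <;> simp

end Gaussian

/-! ### Unitary matrices as real orthogonal matrices. -/

section Complexify

variable {A : Type*}

/-- The complex vector with real parts `w (inl a) / √2` and imaginary parts `w (inr a) / √2`. -/
noncomputable def complexify (w : A ⊕ A → ℝ) (a : A) : ℂ :=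
  ((w (.inl a) / √2 : ℝ) : ℂ) + Complex.I * ((w (.inr a) / √2 : ℝ) : ℂ)

/-- The real matrix that represents a complex matrix on real and imaginary parts. -/
def realify (G : Matrix A A ℂ) : Matrix (A ⊕ A) (A ⊕ A) ℝ :=
  fromBlocks (G.map Complex.re) (-(G.map Complex.im)) (G.map Complex.im) (G.map Complex.re)

lemma complexify_realify_mulVec [Fintype A] (G : Matrix A A ℂ) (w : A ⊕ A → ℝ) :
    complexify (realify G *ᵥ w) = G *ᵥ complexify w := by
  ext a
  apply Complex.ext
  · simp [complexify, realify, mulVec, dotProduct, Finset.sum_neg_distrib, Finset.sum_sub_distrib,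
      ← sub_eq_add_neg]
    rw [sub_div, Finset.sum_div, Finset.sum_div]
    congr 1 <;> exact Finset.sum_congr rfl fun _ _ => by ring
  · simp [complexify, realify, mulVec, dotProduct, Finset.sum_div,
      Finset.sum_add_distrib, add_div]
    rw [add_comm]
    congr 1 <;> exact Finset.sum_congr rfl fun _ _ => by ring

lemma realify_mul_transpose [Fintype A] [DecidableEq A] {G : Matrix A A ℂ}
    (hG : G ∈ unitaryGroup A ℂ) : realify G * (realify G)ᵀ = 1 := by
  have h := mem_unitaryGroup_iff.1 hG
  have hre : ∀ a b, ∑ k, ((G a k).re * (G b k).re + (G a k).im * (G b k).im) =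
      (1 : Matrix A A ℝ) a b := by
    intro a b
    have := congrArg Complex.re (congrFun (congrFun h a) b)
    rw [mul_apply, Complex.re_sum] at this
    simpa [one_apply, apply_ite Complex.re] using this
  have him : ∀ a b, ∑ k, ((G a k).im * (G b k).re - (G a k).re * (G b k).im) = 0 := by
    intro a b
    have := congrArg Complex.im (congrFun (congrFun h a) b)
    rw [mul_apply, Complex.im_sum] at this
    simp only [star_apply, RCLike.star_def, Complex.mul_im, Complex.conj_re, Complex.conj_im,
      one_apply, apply_ite Complex.im, Complex.one_im, Complex.zero_im, ite_self] at this
    rw [← this]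
    exact Finset.sum_congr rfl fun k _ => by ring
  rw [realify, fromBlocks_transpose, fromBlocks_multiply, ← fromBlocks_one]
  congr 1 <;> ext a b
  · simpa [mul_apply, ← Finset.sum_add_distrib] using hre a b
  · have := him b a
    simp only [mul_apply, Matrix.add_apply, transpose_apply, map_apply, Matrix.neg_apply,
      Matrix.zero_apply, ← Finset.sum_add_distrib]
    rw [← this]
    exact Finset.sum_congr rfl fun k _ => by ring
  · have := him a b
    simp only [mul_apply, Matrix.add_apply, transpose_apply, map_apply, Matrix.neg_apply,
      Matrix.zero_apply, ← Finset.sum_add_distrib]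
    rw [← this]
    exact Finset.sum_congr rfl fun k _ => by ring
  · rw [← hre a b]
    simp only [mul_apply, Matrix.add_apply, transpose_apply, map_apply,
      ← Finset.sum_add_distrib]
    exact Finset.sum_congr rfl fun k _ => by ring

end Complexify

section MatrixSlice

variable {R ι : Type*} {N : ℕ}

/-- The complex matrix at time `l`. -/
noncomputable def slice (w : ((R × Fin N) ⊕ (R × Fin N)) × ι → ℝ) (l : ι) :
    Matrix R (Fin N) ℂ :=
  Matrix.of fun i j => complexify (fun q => w (q, l)) (i, j)

open scoped Kronecker in
-- This is the vectorisation identity `vec (U * M * V) = (U ⊗ Vᵀ) vec M` for row-major indexing.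
lemma slice_rotate [Fintype R] (U : Matrix R R ℂ) (V : Matrix (Fin N) (Fin N) ℂ)
    (w : ((R × Fin N) ⊕ (R × Fin N)) × ι → ℝ) (l : ι) :
    slice (rotate (realify (U ⊗ₖ Vᵀ)) w) l = U * slice w l * V := by
  ext i j
  have h := congrFun (complexify_realify_mulVec (U ⊗ₖ Vᵀ) fun q => w (q, l)) (i, j)
  refine h.trans ?_
  simp only [mulVec, dotProduct, kroneckerMap_apply, transpose_apply, Fintype.sum_prod_type,
    mul_apply, Finset.sum_mul, slice, of_apply]
  rw [Finset.sum_comm]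
  exact Finset.sum_congr rfl fun _ _ => Finset.sum_congr rfl fun _ _ => by ring

lemma measurable_slice_apply (l : ι) (i : R) (j : Fin N) :
    Measurable fun w : ((R × Fin N) ⊕ (R × Fin N)) × ι → ℝ => slice w l i j := by
  simp only [slice, complexify, of_apply]
  fun_prop

end MatrixSlice

/-! ### Conditional probabilities and conditional independence. -/

section CondExp

variable {Ω : Type*} {m mT mR m₀ : MeasurableSpace Ω} {P : Measure Ω} [IsProbabilityMeasure P]

/-- If `W` is independent of `Y` and the law of `(y, W)` gives the set `B` a mass that depends on
`y` only through `π y`, then the probability of `(Y, W) ∈ B` given any information between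
`π Y` and `Y` is a function of `π Y`. -/
lemma condExp_preimage_of_indepFun {𝒴 𝒲 𝒳 : Type*} [MeasurableSpace 𝒴] [MeasurableSpace 𝒲]
    [m𝒳 : MeasurableSpace 𝒳] {Y : Ω → 𝒴} {W : Ω → 𝒲} (hY : Measurable Y) (hW : Measurable W)
    (h : IndepFun Y W P) {π : 𝒴 → 𝒳} {B : Set (𝒴 × 𝒲)} (hB : MeasurableSet B)
    {g : 𝒳 → ℝ} (hg : Measurable g) (hgB : ∀ y, (P.map W).real (Prod.mk y ⁻¹' B) = g (π y))
    (hm : MeasurableSpace.comap (fun ω => π (Y ω)) m𝒳 ≤ m)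
    (hmY : m ≤ MeasurableSpace.comap Y inferInstance) :
    P⟦(fun ω => (Y ω, W ω)) ⁻¹' B | m⟧ =ᵐ[P] fun ω => g (π (Y ω)) := by
  have hm0 : m ≤ m₀ := hmY.trans hY.comap_le
  have hPW : IsProbabilityMeasure (P.map W) := Measure.isProbabilityMeasure_map hW.aemeasurable
  have hPY : IsProbabilityMeasure (P.map Y) := Measure.isProbabilityMeasure_map hY.aemeasurable
  have hE : MeasurableSet ((fun ω => (Y ω, W ω)) ⁻¹' B) := (hY.prodMk hW) hB
  have hgm : Measurable[m] fun ω => g (π (Y ω)) :=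
    (hg.comp (comap_measurable _)).mono hm le_rfl
  have hgY : Measurable fun y => g (π y) := by
    simp_rw [← hgB]
    exact (measurable_measure_prodMk_left hB).ennreal_toReal
  have hgi : Integrable (fun ω => g (π (Y ω))) P := by
    refine Integrable.of_bound (hgm.mono hm0 le_rfl).aestronglyMeasurable 1 (ae_of_all _ fun ω => ?_)
    rw [← hgB, Real.norm_of_nonneg measureReal_nonneg]
    exact measureReal_le_one
  symm
  refine ae_eq_condExp_of_forall_setIntegral_eq hm0 ((integrable_const _).indicator hE)
    (fun s _ _ => hgi.integrableOn) (fun s hs _ => ?_) hgm.aestronglyMeasurable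
  obtain ⟨s, hs', rfl⟩ := hmY s hs
  rw [setIntegral_indicator hE, setIntegral_const, smul_eq_mul, mul_one,
    ← setIntegral_map (f := fun y => g (π y)) hs' hgY.aestronglyMeasurable hY.aemeasurable]
  simp_rw [← hgB, measureReal_def]
  rw [integral_toReal (measurable_measure_prodMk_left hB).aemeasurable
    (ae_of_all _ fun _ => measure_lt_top _ _)]
  congr 1
  -- Independence makes the joint law a product, so Fubini computes the mass over `s` by integrating
  -- the masses of the fibres of `B`.
  have hprod := (indepFun_iff_map_prod_eq_prod_map_map hY.aemeasurable hW.aemeasurable).1 h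
  have h1 : P (Y ⁻¹' s ∩ (fun ω => (Y ω, W ω)) ⁻¹' B) =
      (P.map fun ω => (Y ω, W ω)) (Prod.fst ⁻¹' s ∩ B) := by
    rw [Measure.map_apply (hY.prodMk hW) ((measurable_fst hs').inter hB)]
    rfl
  rw [h1, hprod, Measure.prod_apply ((measurable_fst hs').inter hB), ← lintegral_indicator hs']
  refine lintegral_congr fun y => ?_
  by_cases hy : y ∈ s <;> simp [hy, Set.preimage_inter, ← Set.preimage_comp, Function.comp_def]

/-- Both sides equal the integral of the product of the two conditional probabilities. -/
lemma setIntegral_condExp_indicator_eq (hm : m ≤ m₀) {A S : Set Ω}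
    (hA : MeasurableSet A) (hS : MeasurableSet S) :
    ∫ ω in S, (P⟦A | m⟧) ω ∂P = ∫ ω in A, (P⟦S | m⟧) ω ∂P := by
  have key : ∀ {A S : Set Ω}, MeasurableSet A → MeasurableSet S →
      ∫ ω in S, (P⟦A | m⟧) ω ∂P = ∫ ω, (P⟦S | m⟧) ω * (P⟦A | m⟧) ω ∂P := by
    intro A S hA hS
    have hmul : S.indicator (fun _ => (1 : ℝ)) * P⟦A | m⟧ = S.indicator (P⟦A | m⟧) := by
      ext ω; by_cases hω : ω ∈ S <;> simp [hω]
    rw [← integral_indicator hS, ← hmul, ← integral_condExp hm]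
    refine integral_congr_ae (condExp_mul_of_stronglyMeasurable_right stronglyMeasurable_condExp
      ?_ ((integrable_const _).indicator hS))
    rw [hmul]
    exact integrable_condExp.indicator hS
  rw [key hA hS, key hS hA]
  simp_rw [mul_comm]

/-- Conditional independence of the past and the future given the present is symmetric. -/
lemma condExp_eq_of_condExp_swap (hmT : m ≤ mT) (hT : mT ≤ m₀)
    (hR : mR ≤ m₀) (h : ∀ A, MeasurableSet[mT] A → P⟦A | m ⊔ mR⟧ =ᵐ[P] P⟦A | m⟧) {S : Set Ω}
    (hS : MeasurableSet[mR] S) : P⟦S | mT⟧ =ᵐ[P] P⟦S | m⟧ := by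
  have hm : m ≤ m₀ := hmT.trans hT
  symm
  refine ae_eq_condExp_of_forall_setIntegral_eq hT ((integrable_const _).indicator (hR S hS))
    (fun s _ _ => integrable_condExp.integrableOn) (fun A hA _ => ?_)
    (stronglyMeasurable_condExp.mono hmT).aestronglyMeasurable
  have hA0 := hT A hA
  have hS0 := hR S hS
  rw [← setIntegral_condExp_indicator_eq hm hA0 hS0,
    ← setIntegral_congr_ae hS0 ((h A hA).mono fun _ hω _ => hω),
    setIntegral_condExp (sup_le hm hR) ((integrable_const _).indicator hA0)
      (le_sup_right (a := m) S hS), setIntegral_indicator hA0, setIntegral_indicator hS0,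
    Set.inter_comm]

end CondExp

/-! ### The Brownian family as one Gaussian process. -/

section Field

variable {Ω : Type*} [MeasurableSpace Ω] {P : Measure Ω} {b c : ℕ → ℕ → ℝ≥0 → Ω → ℝ}

/-- The real Brownian motions `b i j` and `c i j` as one family. -/
def field (b c : ℕ → ℕ → ℝ≥0 → Ω → ℝ) (q : (ℕ × ℕ) ⊕ (ℕ × ℕ)) (t : ℝ≥0) (ω : Ω) : ℝ :=
  Sum.elim (fun ij => b ij.1 ij.2 t ω) (fun ij => c ij.1 ij.2 t ω) q

namespace IsBrownianFamily

variable (h : IsBrownianFamily b c P)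
include h

lemma measurable_field (q t) : Measurable (field b c q t) := by
  rcases q with q | q
  · exact h.measurable_left _ _ _
  · exact h.measurable_right _ _ _

lemma isPreBrownianReal_field (q) : IsPreBrownianReal (field b c q) P := by
  rcases q with q | q
  · exact (h.brownian_left _ _).toIsPreBrownianReal
  · exact (h.brownian_right _ _).toIsPreBrownianReal

lemma isGaussianProcess_field :
    IsGaussianProcess (fun q : ((ℕ × ℕ) ⊕ (ℕ × ℕ)) × ℝ≥0 => field b c q.1 q.2) P :=
  isGaussianProcess_of_iIndepFun (fun q => IsPreBrownianReal.isGaussianProcess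
    (h.isPreBrownianReal_field q)) h.indep

lemma memLp_field (q t) : MemLp (field b c q t) 2 P :=
  (h.isGaussianProcess_field.hasGaussianLaw_eval (q, t)).memLp_two

lemma covariance_field (q q' s t) :
    cov[field b c q s, field b c q' t; P] = if q = q' then ((min s t : ℝ≥0) : ℝ) else 0 := by
  split_ifs with hq
  · subst hq
    exact (h.isPreBrownianReal_field q).covariance_eval s t
  · exact ((h.indep.indepFun hq).comp (measurable_pi_apply s)
      (measurable_pi_apply t)).covariance_eq_zero (h.memLp_field q s) (h.memLp_field q' t)

end IsBrownianFamily

end Field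

/-! ### Splitting the rows into the top `n` and the rest. -/

section Rows

variable {n β N : ℕ}

/-- The index in `ℕ` of a row of a matrix with `n + β` rows. -/
def rowIndex : Fin n ⊕ Fin β → ℕ := Sum.elim (fun i => i) (fun i => n + i)

lemma rowIndex_injective : Function.Injective (rowIndex (n := n) (β := β)) := by
  rintro (i | i) (j | j) hij <;> simp only [rowIndex, Sum.elim_inl, Sum.elim_inr] at hij
  · rw [Fin.ext hij]
  · omega
  · omega
  · rw [Fin.ext (by omega : (i : ℕ) = j)]

/-- The embedding of real and imaginary entry indices into those of the Brownian family. -/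
def entryIndex : ((Fin n ⊕ Fin β) × Fin N) ⊕ ((Fin n ⊕ Fin β) × Fin N) → (ℕ × ℕ) ⊕ (ℕ × ℕ) :=
  Sum.map (Prod.map rowIndex Fin.val) (Prod.map rowIndex Fin.val)

lemma entryIndex_injective : Function.Injective (entryIndex (n := n) (β := β) (N := N)) :=
  Function.Injective.sumMap (rowIndex_injective.prodMap Fin.val_injective)
    (rowIndex_injective.prodMap Fin.val_injective)

/-- Whether the row of an entry is one of the first `n`. -/
def isTop : ((Fin n ⊕ Fin β) × Fin N) ⊕ ((Fin n ⊕ Fin β) × Fin N) → Bool :=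
  Sum.elim (fun a => a.1.isLeft) (fun a => a.1.isLeft)

/-- The projection onto the first `n + k` rows. -/
def rowProjection (n β k : ℕ) : Matrix (Fin n ⊕ Fin β) (Fin n ⊕ Fin β) ℂ :=
  fromBlocks 1 0 0 (diagonal fun i => if (i : ℕ) < k then 1 else 0)

/-- A unitary matrix acting on the first `n` rows. -/
def extendUnitary (β : ℕ) (U : Matrix (Fin n) (Fin n) ℂ) :
    Matrix (Fin n ⊕ Fin β) (Fin n ⊕ Fin β) ℂ :=
  fromBlocks U 0 0 1

lemma extendUnitary_mem {U : Matrix (Fin n) (Fin n) ℂ} (hU : U ∈ unitaryGroup (Fin n) ℂ) :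
    extendUnitary β U ∈ unitaryGroup (Fin n ⊕ Fin β) ℂ := by
  have h := mem_unitaryGroup_iff.1 hU
  rw [star_eq_conjTranspose] at h
  rw [mem_unitaryGroup_iff, star_eq_conjTranspose, extendUnitary, fromBlocks_conjTranspose,
    fromBlocks_multiply, ← fromBlocks_one]
  simp [h]

lemma rowProjection_mul_extendUnitary (k : ℕ) (U : Matrix (Fin n) (Fin n) ℂ) :
    rowProjection n β k * extendUnitary β U = extendUnitary β U * rowProjection n β k := by
  simp [rowProjection, extendUnitary, fromBlocks_multiply]

open scoped Kronecker in
-- The block form of `extendUnitary` never mixes top and bottom rows; this supplies the hypothesis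
-- `hOK` of `map_rotate_eq`.
lemma isTop_eq_of_realify_ne_zero {U : Matrix (Fin n) (Fin n) ℂ} {V : Matrix (Fin N) (Fin N) ℂ}
    {q q' : ((Fin n ⊕ Fin β) × Fin N) ⊕ ((Fin n ⊕ Fin β) × Fin N)}
    (h : realify (extendUnitary β U ⊗ₖ Vᵀ) q q' ≠ 0) : isTop q = isTop q' := by
  rcases q with ⟨i | i, j⟩ | ⟨i | i, j⟩ <;> rcases q' with ⟨i' | i', j'⟩ | ⟨i' | i', j'⟩ <;>
    first
    | rfl
    | exact absurd (by simp [realify, extendUnitary, kroneckerMap_apply]) h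

/-- The rows `F 0, ..., F (n + β - 1)` as a matrix. -/
def rowsMatrix (n β : ℕ) (F : ℕ → Fin N → ℂ) : Matrix (Fin n ⊕ Fin β) (Fin N) ℂ :=
  Matrix.of fun i j => F (rowIndex i) j

/-- Zeroing rows has the same effect on the Gram matrix as deleting them, so points with different
row numbers can share one matrix shape. -/
lemma gram_rowProjection_mul (F : ℕ → Fin N → ℂ) {k : ℕ} (hk : k ≤ β) :
    (Matrix.of fun (i : Fin (n + k)) j => F i j)ᴴ * (Matrix.of fun (i : Fin (n + k)) j => F i j) =
      (rowProjection n β k * rowsMatrix n β F)ᴴ *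
        (rowProjection n β k * rowsMatrix n β F) := by
  have hrow : ∀ i j, (rowProjection n β k * rowsMatrix n β F) i j =
      Sum.elim (fun i : Fin n => F i j)
        (fun i : Fin β => if (i : ℕ) < k then F (n + i) j else 0) i := by
    rintro (i | i) j
    · simp [rowProjection, mul_apply, Fintype.sum_sum_type, one_apply, rowIndex, rowsMatrix]
    · simp [rowProjection, mul_apply, Fintype.sum_sum_type, diagonal_apply, rowIndex, rowsMatrix]
  ext j j'
  rw [mul_apply, mul_apply]
  simp only [conjTranspose_apply, of_apply, hrow, Fintype.sum_sum_type, Sum.elim_inl,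
    Sum.elim_inr]
  rw [Fin.sum_univ_eq_sum_range (fun i => star (F i j) * F i j'),
    Fin.sum_univ_eq_sum_range (fun i => star (F i j) * F i j'), Finset.sum_range_add,
    Fin.sum_univ_eq_sum_range (fun i => star (if i < k then F (n + i) j else 0) *
      (if i < k then F (n + i) j' else 0)), ← Finset.sum_range_add_sum_Ico _ hk]
  congr 1
  rw [Finset.sum_eq_zero (s := Finset.Ico k β) fun i hi => by
    simp [(Finset.mem_Ico.1 hi).1.not_gt], add_zero]
  refine Finset.sum_congr rfl fun i hi => ?_
  simp [Finset.mem_range.1 hi]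

end Rows

/-! ### Eigenvalues as functions of the present matrix and the noise. -/

section Update

variable {n β N : ℕ} {ι : Type*}

/-- The ordered squared singular values of the first `n + k l` rows of `γ l * (a; 0) + w l`. -/
noncomputable def updatedEigenvalues (γ : ι → ℝ) (k : ι → ℕ) (a : Matrix (Fin n) (Fin N) ℂ)
    (w : (((Fin n ⊕ Fin β) × Fin N) ⊕ ((Fin n ⊕ Fin β) × Fin N)) × ι → ℝ) (l : ι) : Fin N → ℝ :=
  gramEigenvalues (rowProjection n β (k l) * ((γ l : ℂ) •
    (fromRows a 0 : Matrix (Fin n ⊕ Fin β) (Fin N) ℂ) + slice w l))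

open scoped Kronecker in
lemma updatedEigenvalues_rotate (γ : ι → ℝ) (k : ι → ℕ) (a : Matrix (Fin n) (Fin N) ℂ)
    (w : (((Fin n ⊕ Fin β) × Fin N) ⊕ ((Fin n ⊕ Fin β) × Fin N)) × ι → ℝ)
    {U : Matrix (Fin n) (Fin n) ℂ} {V : Matrix (Fin N) (Fin N) ℂ}
    (hU : U ∈ unitaryGroup (Fin n) ℂ) (hV : V ∈ unitaryGroup (Fin N) ℂ) :
    updatedEigenvalues γ k (U * a * V) (rotate (realify (extendUnitary β U ⊗ₖ Vᵀ)) w) =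
      updatedEigenvalues γ k a w := by
  funext l
  have hrows : (fromRows (U * a * V) 0 : Matrix (Fin n ⊕ Fin β) (Fin N) ℂ) =
      extendUnitary β U * (fromRows a 0 : Matrix (Fin n ⊕ Fin β) (Fin N) ℂ) * V := by
    rw [extendUnitary, fromBlocks_mul_fromRows, fromRows_mul]
    simp
  unfold updatedEigenvalues
  rw [slice_rotate, hrows, ← Matrix.smul_mul, ← Matrix.mul_smul,
    ← Matrix.add_mul, ← Matrix.mul_add, ← Matrix.mul_assoc, gramEigenvalues_mul_unitary _ hV,
    ← Matrix.mul_assoc, rowProjection_mul_extendUnitary, Matrix.mul_assoc,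
    gramEigenvalues_unitary_mul _ (extendUnitary_mem hU)]

lemma measurable_updatedEigenvalues {Ω : Type*} [MeasurableSpace Ω] (γ : ι → ℝ) (k : ι → ℕ)
    {a : Ω → Matrix (Fin n) (Fin N) ℂ} (ha : ∀ i j, Measurable fun ω => a ω i j)
    {w : Ω → (((Fin n ⊕ Fin β) × Fin N) ⊕ ((Fin n ⊕ Fin β) × Fin N)) × ι → ℝ}
    (hw : Measurable w) : Measurable fun ω => updatedEigenvalues γ k (a ω) (w ω) := by
  refine measurable_pi_lambda _ fun l => measurable_gramEigenvalues fun i j => ?_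
  simp only [mul_apply, Matrix.add_apply, Matrix.smul_apply]
  refine Finset.measurable_fun_sum _ fun i' _ => measurable_const.mul
    (Measurable.add (Measurable.const_smul (c := (γ l : ℂ)) ?_)
      ((measurable_slice_apply _ _ _).comp hw))
  rcases i' with i' | i'
  · simpa using ha i' j
  · simp

open scoped Kronecker in
-- The unitaries in the singular value decomposition of `a` are moved onto the noise, whose law
-- absorbs them.
lemma measure_updatedEigenvalues_eq {α : ℕ} (γ : ι → ℝ) (k : ι → ℕ)
    {μ : Measure ((((Fin (N + α) ⊕ Fin β) × Fin N) ⊕ ((Fin (N + α) ⊕ Fin β) × Fin N)) × ι → ℝ)}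
    (hμ : ∀ U ∈ unitaryGroup (Fin (N + α)) ℂ, ∀ V ∈ unitaryGroup (Fin N) ℂ,
      μ.map (rotate (realify (extendUnitary β U ⊗ₖ Vᵀ))) = μ)
    {S : Set (ι → Fin N → ℝ)} (hS : MeasurableSet S) (a : Matrix (Fin (N + α)) (Fin N) ℂ) :
    μ.real {w | updatedEigenvalues γ k a w ∈ S} =
      μ.real {w | updatedEigenvalues γ k (rectDiagonal (N + α) (gramEigenvalues a)) w ∈ S} := by
  obtain ⟨U, hU, V, hV, ha⟩ := exists_singular_value_decomposition a
  have hset : MeasurableSet {w | updatedEigenvalues (β := β) γ k a w ∈ S} :=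
    measurableSet_preimage (measurable_updatedEigenvalues (β := β) γ k (a := fun _ => a)
      (w := fun w => w) (fun _ _ => measurable_const) measurable_id') hS
  have h1 : μ {w | updatedEigenvalues γ k a w ∈ S} =
      μ.map (rotate (realify (extendUnitary β U ⊗ₖ Vᵀ))) {w | updatedEigenvalues γ k a w ∈ S} := by
    rw [hμ U hU V hV]
  rw [measureReal_def, measureReal_def, h1, Measure.map_apply (measurable_rotate _) hset]
  refine congrArg (fun s => (μ s).toReal) (Set.ext fun w => ?_)
  have hw := updatedEigenvalues_rotate γ k (rectDiagonal (N + α) (gramEigenvalues a)) w hU hV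
  rw [← ha] at hw
  rw [Set.mem_preimage, Set.mem_ofPred_eq, Set.mem_ofPred_eq, hw]

lemma measurable_rectDiagonal_apply {n : ℕ} (i : Fin n) (j : Fin N) :
    Measurable fun x : Fin N → ℝ => rectDiagonal n x i j := by
  simp only [rectDiagonal, of_apply]
  split_ifs <;> fun_prop

end Update

/-! ### Regression on the present, and the law of the residuals. -/

section Core

variable {Ω : Type*} {b c : ℕ → ℕ → ℝ≥0 → Ω → ℝ}

/-- The coefficient of the regression of `B t` on `B s` for a Brownian motion `B`. -/
noncomputable def regression (s t : ℝ≥0) : ℝ := ((min t s / s : ℝ≥0) : ℝ)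

/-- The process on the times `T` restricted to the first `n` rows. -/
def observed (b c : ℕ → ℕ → ℝ≥0 → Ω → ℝ) (n N : ℕ) (T : Set ℝ≥0)
    (q : ((Fin n × Fin N) ⊕ (Fin n × Fin N)) × T) : Ω → ℝ :=
  field b c (Sum.map (Prod.map Fin.val Fin.val) (Prod.map Fin.val Fin.val) q.1) q.2

/-- The entries at the times `t l`, where those in the first `n` rows are replaced by their
regression residuals with respect to time `s`. -/
noncomputable def residual (b c : ℕ → ℕ → ℝ≥0 → Ω → ℝ) (n β N : ℕ) (s : ℝ≥0) {ι : Type*}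
    (t : ι → ℝ≥0) (q : (((Fin n ⊕ Fin β) × Fin N) ⊕ ((Fin n ⊕ Fin β) × Fin N)) × ι) (ω : Ω) : ℝ :=
  field b c (entryIndex q.1) (t q.2) ω -
    (if isTop q.1 then regression s (t q.2) else 0) * field b c (entryIndex q.1) s ω

lemma rowsMatrix_complexBM_eq (n β N : ℕ) (T : Set ℝ≥0) (s : T) {ι : Type*} (t : ι → ℝ≥0) (l : ι)
    (ω : Ω) : rowsMatrix (N := N) n β (fun i j => complexBM b c i j (t l) ω) =
      ((regression s (t l) : ℝ) : ℂ) •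
        (fromRows (slice (fun q => observed b c n N T q ω) s) 0 :
          Matrix (Fin n ⊕ Fin β) (Fin N) ℂ) +
        slice (fun q => residual b c n β N s t q ω) l := by
  ext i j
  rcases i with i | i
  · simp [rowsMatrix, rowIndex, slice, complexify, residual, observed, complexBM, field,
      entryIndex, isTop]
    ring
  · simp [rowsMatrix, rowIndex, slice, complexify, residual, complexBM, field,
      entryIndex, isTop]

lemma eigenvalueVector_eq_updatedEigenvalues {N α β : ℕ} (T : Set ℝ≥0) (s : T) {ι : Type*}
    (p : ι → ℕ × ℝ≥0) (hp : ∀ l, α ≤ (p l).1) (hβ : ∀ l, (p l).1 ≤ α + β) (ω : Ω) :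
    (fun l => eigenvalueVector b c N (p l).1 (p l).2 ω) =
      updatedEigenvalues (fun l => regression s (p l).2) (fun l => (p l).1 - α)
        (slice (fun q => observed b c (N + α) N T q ω) s)
        (fun q => residual b c (N + α) β N s (fun l => (p l).2) q ω) := by
  funext l
  obtain ⟨k, hk⟩ := Nat.exists_eq_add_of_le (hp l)
  have hkβ : k ≤ β := by have := hβ l; omega
  unfold updatedEigenvalues
  rw [← rowsMatrix_complexBM_eq (N + α) β N T s (fun l => (p l).2) l ω]
  simp only [hk, Nat.add_sub_cancel_left]
  rw [← gramEigenvalues_eq_of_gram_eq (gram_rowProjection_mul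
    (fun i (j : Fin N) => complexBM b c i j (p l).2 ω) hkβ)]
  have : ∀ α' n, n = N + α' → eigenvalueVector b c N α' (p l).2 ω = gramEigenvalues
      (Matrix.of fun (i : Fin n) (j : Fin N) => complexBM b c i j (p l).2 ω) := by
    rintro α' _ rfl; rfl
  exact this _ _ (Nat.add_assoc _ _ _)

variable {m₀ : MeasurableSpace Ω} {P : Measure Ω} (h : IsBrownianFamily b c P)
include h

lemma IsBrownianFamily.measurable_residual {n β N : ℕ} {s : ℝ≥0} {ι : Type*} (t : ι → ℝ≥0) (q) :
    Measurable (residual b c n β N s t q) :=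
  (h.measurable_field _ _).sub ((h.measurable_field _ _).const_mul _)

lemma IsBrownianFamily.isGaussianProcess_residual_observed {n β N : ℕ} {s : ℝ≥0} {ι : Type*}
    (t : ι → ℝ≥0) (T : Set ℝ≥0) :
    IsGaussianProcess (Sum.elim (residual b c n β N s t) (observed b c n N T)) P := by
  classical
  have hG := h.isGaussianProcess_field
  refine IsGaussianProcess.of_isGaussianProcess hG ?_
  rintro (q | q)
  · refine ⟨{(entryIndex q.1, t q.2), (entryIndex q.1, s)},
      ContinuousLinearMap.proj ⟨(entryIndex q.1, t q.2), by simp⟩ -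
        (if isTop q.1 then regression s (t q.2) else 0 : ℝ) •
          ContinuousLinearMap.proj ⟨(entryIndex q.1, s), by simp⟩, fun ω => ?_⟩
    by_cases hq : isTop q.1 <;> simp [residual, hq]
  · exact ⟨{(_, q.2.1)}, ContinuousLinearMap.proj ⟨_, Finset.mem_singleton_self _⟩, fun ω => rfl⟩

lemma IsBrownianFamily.memLp_residual {n β N : ℕ} {s : ℝ≥0} {ι : Type*} (t : ι → ℝ≥0) (q) :
    MemLp (residual b c n β N s t q) 2 P :=
  (h.memLp_field _ _).sub ((h.memLp_field _ _).const_mul _)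

lemma IsBrownianFamily.covariance_residual_left [IsProbabilityMeasure P] {n β N : ℕ} {s : ℝ≥0}
    {ι : Type*} (t : ι → ℝ≥0) (q) {X : Ω → ℝ} (hX : MemLp X 2 P) :
    cov[residual b c n β N s t q, X; P] = cov[field b c (entryIndex q.1) (t q.2), X; P] -
      (if isTop q.1 then regression s (t q.2) else 0) *
        cov[field b c (entryIndex q.1) s, X; P] := by
  rw [← covariance_const_mul_left, ← covariance_fun_sub_left (h.memLp_field _ _)
    ((h.memLp_field _ _).const_mul _) hX]
  rfl

/-- For jointly Gaussian families vanishing covariance suffices. In the top rows it amounts to `min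
t u = (min t s / s) * min s u` for `s` between `t` and `u`; the lower rows are not observed at all.
-/
lemma IsBrownianFamily.indepFun_observed_residual [IsProbabilityMeasure P] {n β N : ℕ} {s : ℝ≥0}
    {ι : Type*} (t : ι → ℝ≥0) (T : Set ℝ≥0)
    (hT : ∀ l, ∀ u ∈ T, (t l ≤ s ∧ s ≤ u) ∨ (u ≤ s ∧ s ≤ t l)) :
    IndepFun (fun ω q => observed b c n N T q ω) (fun ω q => residual b c n β N s t q ω) P := by
  refine (IsGaussianProcess.indepFun_of_covariance_eq_zero
    (h.isGaussianProcess_residual_observed t T)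
    (fun q => (h.measurable_residual t q).aemeasurable)
    (fun q => (h.measurable_field _ _).aemeasurable) fun q r => ?_).symm
  unfold observed
  rw [h.covariance_residual_left t q (h.memLp_field _ _)]
  simp only [h.covariance_field]
  split_ifs with h1 h2
  · have h3 : min (t q.2) r.2.1 = min (t q.2) s / s * min s r.2.1 := by
      rcases hT q.2 r.2.1 r.2.2 with ⟨h4, h5⟩ | ⟨h4, h5⟩
      · rw [min_eq_left (h4.trans h5), min_eq_left h4, min_eq_left h5]
        -- Division by zero gives `0`, which is harmless: `s = 0` forces the earlier time to be `0`,
        -- so both sides vanish.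
        rcases eq_or_ne s 0 with rfl | hs
        · simpa using h4
        · rw [div_mul_cancel₀ _ hs]
      · rw [min_eq_right (h4.trans h5), min_eq_right h4, min_eq_right h5]
        rcases eq_or_ne s 0 with rfl | hs
        · simpa using h4
        · rw [div_self hs, one_mul]
    rw [h3, regression]
    push_cast
    ring
  · exfalso
    obtain ⟨q, l⟩ := q
    obtain ⟨r, u⟩ := r
    rcases q with ⟨i | i, j⟩ | ⟨i | i, j⟩ <;> rcases r with ⟨i', j'⟩ | ⟨i', j'⟩ <;>
      simp [entryIndex, rowIndex, isTop] at h1 h2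
    all_goals omega
  all_goals simp

open scoped Kronecker in
lemma IsBrownianFamily.map_residual_rotate [IsProbabilityMeasure P] {n β N : ℕ} {s : ℝ≥0}
    {ι : Type*} [Fintype ι] (t : ι → ℝ≥0) {U : Matrix (Fin n) (Fin n) ℂ}
    (hU : U ∈ unitaryGroup (Fin n) ℂ) {V : Matrix (Fin N) (Fin N) ℂ}
    (hV : V ∈ unitaryGroup (Fin N) ℂ) :
    (P.map fun ω q => residual b c n β N s t q ω).map
      (rotate (realify (extendUnitary β U ⊗ₖ Vᵀ))) =
      P.map fun ω q => residual b c n β N s t q ω := by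
  classical
  have hG : HasGaussianLaw (fun ω q => residual b c n β N s t q ω) P :=
    hasGaussianLaw_of_isGaussianProcess
      ((h.isGaussianProcess_residual_observed t ∅).comp_right Sum.inl)
  have hVt : Vᵀ ∈ unitaryGroup (Fin N) ℂ := transpose_mem_unitaryGroup_iff.2 hV
  -- The kernel is the covariance of two residuals of one entry, expanded bilinearly; it depends on
  -- the entry only through `isTop`.
  refine map_rotate_eq hG (fun q => ?_) (fun q l l' =>
    ((min (t l) (t l') : ℝ≥0) : ℝ) - (if isTop q then regression s (t l') else 0) *
      ((min (t l) s : ℝ≥0) : ℝ) - (if isTop q then regression s (t l) else 0) *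
      (((min s (t l') : ℝ≥0) : ℝ) - (if isTop q then regression s (t l') else 0) *
        ((min s s : ℝ≥0) : ℝ))) (fun q q' => ?_)
    (realify_mul_transpose (kronecker_mem_unitary (extendUnitary_mem hU) hVt)) fun q q' hq => ?_
  · have hi : ∀ u, Integrable (field b c (entryIndex q.1) u) P := fun u =>
      (h.memLp_field _ u).integrable (by norm_num)
    simp only [residual]
    rw [integral_sub (hi _) ((hi _).const_mul _), integral_const_mul,
      (h.isPreBrownianReal_field _).integral_eval, (h.isPreBrownianReal_field _).integral_eval]
    simp
  · rw [h.covariance_residual_left t q (h.memLp_residual t q'), covariance_comm,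
      h.covariance_residual_left t q' (h.memLp_field _ _), covariance_comm,
      covariance_comm (field b c (entryIndex q'.1) s),
      covariance_comm _ (residual b c n β N s t q'),
      h.covariance_residual_left t q' (h.memLp_field _ _),
      covariance_comm (field b c (entryIndex q'.1) (t q'.2)),
      covariance_comm (field b c (entryIndex q'.1) s)]
    simp only [h.covariance_field, entryIndex_injective.eq_iff]
    by_cases hq : q.1 = q'.1
    · simp [hq]
    · simp [hq]
  · simp only [isTop_eq_of_realify_ne_zero hq]

end Core

/-- Given the eigenvalues at `(α, s)`, those at points with more rows on one side of time `s` are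
conditionally independent of any information on the first `N + α` rows on the other side. -/
lemma IsBrownianFamily.condExp_eigenvalueVector {Ω : Type*} {b c : ℕ → ℕ → ℝ≥0 → Ω → ℝ}
    {m m₀ : MeasurableSpace Ω} {P : Measure Ω} (h : IsBrownianFamily b c P)
    [IsProbabilityMeasure P] {N α : ℕ} {ι : Type*}
    [Finite ι] (p : ι → ℕ × ℝ≥0) {T : Set ℝ≥0} (s : T) (hp : ∀ l, α ≤ (p l).1)
    (hT : ∀ l, ∀ u ∈ T, ((p l).2 ≤ s ∧ (s : ℝ≥0) ≤ u) ∨ (u ≤ s ∧ (s : ℝ≥0) ≤ (p l).2))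
    {S : Set (ι → Fin N → ℝ)} (hS : MeasurableSet S)
    (hm : MeasurableSpace.comap (eigenvalueVector b c N α s) inferInstance ≤ m)
    (hmT : m ≤ MeasurableSpace.comap (fun ω q => observed b c (N + α) N T q ω) inferInstance) :
    P⟦(fun ω l => eigenvalueVector b c N (p l).1 (p l).2 ω) ⁻¹' S | m⟧ =ᵐ[P]
      P⟦(fun ω l => eigenvalueVector b c N (p l).1 (p l).2 ω) ⁻¹' S |
        MeasurableSpace.comap (eigenvalueVector b c N α s) inferInstance⟧ := by
  have := Fintype.ofFinite ι
  obtain ⟨β, hβ⟩ : ∃ β, ∀ l, (p l).1 ≤ α + β := ⟨∑ l, (p l).1, fun l =>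
    (Finset.single_le_sum (f := fun l => (p l).1) (fun _ _ => Nat.zero_le _)
      (Finset.mem_univ l)).trans (Nat.le_add_left _ _)⟩
  set γ : ι → ℝ := fun l => regression s (p l).2
  set k : ι → ℕ := fun l => (p l).1 - α
  set Y : Ω → ((Fin (N + α) × Fin N) ⊕ (Fin (N + α) × Fin N)) × T → ℝ :=
    fun ω q => observed b c (N + α) N T q ω
  set W : Ω → (((Fin (N + α) ⊕ Fin β) × Fin N) ⊕ ((Fin (N + α) ⊕ Fin β) × Fin N)) × ι → ℝ :=
    fun ω q => residual b c (N + α) β N s (fun l => (p l).2) q ω with hWdef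
  have hY : Measurable[m₀] Y := measurable_pi_lambda _ fun q => h.measurable_field _ _
  have hW : Measurable[m₀] W := measurable_pi_lambda _ fun q => h.measurable_residual _ q
  have hind : IndepFun Y W P := h.indepFun_observed_residual _ T hT
  obtain ⟨μ, hμdef⟩ : ∃ μ, μ = @Measure.map _ _ m₀ _ W P := ⟨_, rfl⟩
  have hPμ : IsProbabilityMeasure μ := hμdef ▸ Measure.isProbabilityMeasure_map hW.aemeasurable
  have hinv := fun U hU V hV => h.map_residual_rotate (n := N + α) (β := β) (N := N) (s := s)
    (fun l => (p l).2) (U := U) hU (V := V) hV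
  rw [← hWdef, ← hμdef] at hinv
  let g : (Fin N → ℝ) → ℝ := fun x =>
    μ.real {w | updatedEigenvalues γ k (rectDiagonal (N + α) x) w ∈ S}
  let B := {yw : (((Fin (N + α) × Fin N) ⊕ (Fin (N + α) × Fin N)) × T → ℝ) ×
    ((((Fin (N + α) ⊕ Fin β) × Fin N) ⊕ ((Fin (N + α) ⊕ Fin β) × Fin N)) × ι → ℝ) |
      updatedEigenvalues γ k (slice yw.1 s) yw.2 ∈ S}
  have hB : MeasurableSet B := measurableSet_preimage (measurable_updatedEigenvalues γ k
    (a := fun yw : (((Fin (N + α) × Fin N) ⊕ (Fin (N + α) × Fin N)) × T → ℝ) ×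
    ((((Fin (N + α) ⊕ Fin β) × Fin N) ⊕ ((Fin (N + α) ⊕ Fin β) × Fin N)) × ι → ℝ) =>
      slice yw.1 s) (w := fun yw => yw.2)
    (fun i j => (measurable_slice_apply s i j).comp measurable_fst) measurable_snd) hS
  have hB' : MeasurableSet {xw : (Fin N → ℝ) ×
    ((((Fin (N + α) ⊕ Fin β) × Fin N) ⊕ ((Fin (N + α) ⊕ Fin β) × Fin N)) × ι → ℝ) |
      updatedEigenvalues γ k (rectDiagonal (N + α) xw.1) xw.2 ∈ S} :=
    measurableSet_preimage (measurable_updatedEigenvalues γ k (a := fun xw : (Fin N → ℝ) ×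
      ((((Fin (N + α) ⊕ Fin β) × Fin N) ⊕ ((Fin (N + α) ⊕ Fin β) × Fin N)) × ι → ℝ) =>
      rectDiagonal (N + α) xw.1) (w := fun xw => xw.2)
      (fun i j => (measurable_rectDiagonal_apply i j).comp measurable_fst) measurable_snd) hS
  have hg : Measurable g := (measurable_measure_prodMk_left hB').ennreal_toReal
  have hgB : ∀ y, μ.real (Prod.mk y ⁻¹' B) = g (gramEigenvalues (slice y s)) := fun y =>
    measure_updatedEigenvalues_eq γ k hinv hS (slice y s)
  have hpre : (fun ω l => eigenvalueVector b c N (p l).1 (p l).2 ω) ⁻¹' S =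
      (fun ω => (Y ω, W ω)) ⁻¹' B := by
    ext ω
    simp only [Set.mem_preimage, eigenvalueVector_eq_updatedEigenvalues T s p hp hβ ω]
    rfl
  rw [hpre]
  subst hμdef
  -- Both conditional probabilities equal the same function `g` of the present eigenvalues.
  exact (condExp_preimage_of_indepFun (π := fun y => gramEigenvalues (slice y s))
    hY hW hind hB hg hgB hm hmT).trans (condExp_preimage_of_indepFun
      (π := fun y => gramEigenvalues (slice y s)) hY hW hind hB hg hgB le_rfl (hm.trans hmT)).symm

/-! ### Time-like and space-like paths. -/

section Main

lemma comap_eigenvalueVector_le {Ω : Type*} {b c : ℕ → ℕ → ℝ≥0 → Ω → ℝ} {N α α' : ℕ}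
    (hα : α' ≤ α) {T : Set ℝ≥0} {t : ℝ≥0} (ht : t ∈ T) :
    MeasurableSpace.comap (eigenvalueVector b c N α' t) inferInstance ≤
      MeasurableSpace.comap (fun ω q => observed b c (N + α) N T q ω) inferInstance := by
  have hm : Measurable fun y : ((Fin (N + α) × Fin N) ⊕ (Fin (N + α) × Fin N)) × T → ℝ =>
      gramEigenvalues (Matrix.of fun (i : Fin (N + α')) (j : Fin N) =>
        slice y ⟨t, ht⟩ (Fin.castLE (Nat.add_le_add_left hα N) i) j) :=
    measurable_gramEigenvalues fun i j => measurable_slice_apply _ _ j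
  rintro _ ⟨S, hS, rfl⟩
  exact ⟨_, hm hS, rfl⟩

lemma IsBrownianFamily.measurable_eigenvalueVector {Ω : Type*} [MeasurableSpace Ω]
    {P : Measure Ω} {b c : ℕ → ℕ → ℝ≥0 → Ω → ℝ} (h : IsBrownianFamily b c P) (N α : ℕ)
    (t : ℝ≥0) : Measurable (eigenvalueVector b c N α t) := by
  refine measurable_gramEigenvalues fun i j => ?_
  simp only [randMatrix, complexBM, Matrix.of_apply]
  have := h.measurable_left i j t
  have := h.measurable_right i j t
  fun_prop

lemma fin_le_of_forall_succ {E : Type*} [Preorder E] {m : ℕ} {f : Fin m → E}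
    (h : ∀ (k : ℕ) (hk : k + 1 < m), f ⟨k, k.lt_succ_self.trans hk⟩ ≤ f ⟨k + 1, hk⟩)
    {j k : Fin m} (hjk : j ≤ k) : f j ≤ f k := by
  obtain ⟨k, hk⟩ := k
  obtain ⟨j, hj⟩ := j
  replace hjk : j ≤ k := hjk
  induction k, hjk using Nat.le_induction with
  | base => exact le_rfl
  | succ k hjk ih => exact (ih (k.lt_succ_self.trans hk)).trans (h k hk)

/-- It presents an event of the past as a preimage under one joint vector, the form
`condExp_eigenvalueVector` handles. -/
lemma comap_iSup_pi {Ω ι E : Type*} [mE : MeasurableSpace E] (X : ι → Ω → E) :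
    ⨆ j, MeasurableSpace.comap (X j) mE =
      MeasurableSpace.comap (fun ω j => X j ω) MeasurableSpace.pi := by
  simp [MeasurableSpace.pi, MeasurableSpace.comap_iSup, MeasurableSpace.comap_comp,
    Function.comp_def]

variable {Ω : Type*} [MeasurableSpace Ω] {P : Measure Ω} [IsProbabilityMeasure P]
  {b c : ℕ → ℕ → ℝ≥0 → Ω → ℝ} (h : IsBrownianFamily b c P) (N : ℕ)
include h

lemma IsBrownianFamily.isMarkovChain_of_isTimeLike {m : ℕ} {p : Fin m → ℕ × ℝ≥0}
    (hp : IsTimeLike p) :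
    IsMarkovChain (fun k => eigenvalueVector b c N (p k).1 (p k).2) P where
  measurable k := h.measurable_eigenvalueVector N _ _
  markov k hk S hS := by
    have hα : ∀ {i j}, i ≤ j → (p i).1 ≤ (p j).1 :=
      fin_le_of_forall_succ (f := fun i => (p i).1) fun k hk => (hp k hk).1
    have ht : ∀ {i j}, i ≤ j → (p i).2 ≤ (p j).2 :=
      fin_le_of_forall_succ (f := fun i => (p i).2) fun k hk => (hp k hk).2.1
    let k₀ : Fin m := ⟨k, k.lt_succ_self.trans hk⟩
    let k₁ : Fin m := ⟨k + 1, hk⟩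
    have h01 : k₀ ≤ k₁ := Nat.le_succ k
    refine h.condExp_eigenvalueVector (fun _ : Unit => p k₁) (T := Set.Iic (p k₀).2)
      ⟨(p k₀).2, le_refl (p k₀).2⟩ (fun _ => hα h01) (fun _ u hu => .inr ⟨hu, ht h01⟩)
      (S := {x | x () ∈ S}) (measurable_pi_apply () hS) ?_ ?_
    · exact le_iSup (fun j : {j : Fin m // (j : ℕ) ≤ k} => MeasurableSpace.comap
        (eigenvalueVector b c N (p j).1 (p j).2) inferInstance) ⟨k₀, le_rfl⟩
    · exact iSup_le fun j => comap_eigenvalueVector_le (hα (i := j) (j := k₀) j.2)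
        (ht (i := j) (j := k₀) j.2)

lemma IsBrownianFamily.isMarkovChain_of_isSpaceLike {m : ℕ} {p : Fin m → ℕ × ℝ≥0}
    (hp : IsSpaceLike p) :
    IsMarkovChain (fun k => eigenvalueVector b c N (p k).1 (p k).2) P where
  measurable k := h.measurable_eigenvalueVector N _ _
  markov k hk S hS := by
    have hα : ∀ {i j}, i ≤ j → (p j).1 ≤ (p i).1 :=
      fin_le_of_forall_succ (E := ℕᵒᵈ) (f := fun i => (p i).1) fun k hk => (hp k hk).1
    have ht : ∀ {i j}, i ≤ j → (p i).2 ≤ (p j).2 :=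
      fin_le_of_forall_succ (f := fun i => (p i).2) fun k hk => (hp k hk).2.1
    let k₀ : Fin m := ⟨k, k.lt_succ_self.trans hk⟩
    let k₁ : Fin m := ⟨k + 1, hk⟩
    have h01 : k₀ ≤ k₁ := Nat.le_succ k
    -- Time is reversed: the goal becomes that, given the present, the next point adds nothing to
    -- the prediction of the past.
    refine condExp_eq_of_condExp_swap
      (mR := MeasurableSpace.comap (eigenvalueVector b c N (p k₁).1 (p k₁).2) inferInstance)
      (le_iSup (fun j : {j : Fin m // (j : ℕ) ≤ k} => MeasurableSpace.comap
        (eigenvalueVector b c N (p j).1 (p j).2) inferInstance) ⟨k₀, le_rfl⟩)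
      (iSup_le fun j => (h.measurable_eigenvalueVector N _ _).comap_le)
      (h.measurable_eigenvalueVector N _ _).comap_le (fun A hA => ?_) ⟨S, hS, rfl⟩
    rw [comap_iSup_pi (fun (j : {j : Fin m // (j : ℕ) ≤ k}) =>
      eigenvalueVector b c N (p j).1 (p j).2)] at hA
    obtain ⟨A, hA, rfl⟩ := hA
    exact h.condExp_eigenvalueVector (fun j : {j : Fin m // (j : ℕ) ≤ k} => p j)
      (T := Set.Ici (p k₀).2) ⟨(p k₀).2, le_refl (p k₀).2⟩ (fun j => hα (i := j) (j := k₀) j.2)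
      (fun j u hu => .inl ⟨ht (i := j) (j := k₀) j.2, hu⟩) hA le_sup_left
      (sup_le (comap_eigenvalueVector_le le_rfl (le_refl (p k₀).2))
        (comap_eigenvalueVector_le (hα h01) (ht h01)))

end Main

end LaguerreField

theorem lemma3p1 {Ω : Type*} [MeasurableSpace Ω] (P : Measure Ω) [IsProbabilityMeasure P]
    (b c : ℕ → ℕ → ℝ≥0 → Ω → ℝ) (hbc : LaguerreField.IsBrownianFamily b c P) (N : ℕ) :
    (∀ (m : ℕ) (p : Fin m → ℕ × ℝ≥0), LaguerreField.IsTimeLike p →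
      LaguerreField.IsMarkovChain
        (fun k => LaguerreField.eigenvalueVector b c N (p k).1 (p k).2) P) ∧
    (∀ (m : ℕ) (p : Fin m → ℕ × ℝ≥0), LaguerreField.IsSpaceLike p →
      LaguerreField.IsMarkovChain
        (fun k => LaguerreField.eigenvalueVector b c N (p k).1 (p k).2) P) :=
  ⟨fun _ _ hp => hbc.isMarkovChain_of_isTimeLike N hp,
    fun _ _ hp => hbc.isMarkovChain_of_isSpaceLike N hp⟩
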